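/- Let $X$ be a compact metric space without isolated points, and let $C(X,X)$ be the space of continuous maps $X\to X$ with the topology of uniform convergence. A property holds for a generic $f\in C(X,X)$ if the set of all $f$ having it contains a dense $G_\delta$-subset of $C(X,X)$. For $f\in C(X,X)$ let $CR(f)$ be the set of chain recurrent points of $f$: the points $x$ such that for every $\varepsilon>0$ there are $n\ge 1$ and points $x=x_0,x_1,\dots,x_n=x$ with $d(f(x_{i-1}),x_i)<\varepsilon$ for $i=1,\dots,n$. For $l\ge 1$ let $Per_l(f)$ be the set of periodic points of $f$ whose orbit has at least $l$ elements. Assume that $X$ is an ANR (that is, whenever $X$ is embedded as a closed subset of a metrizable space $Z$, it is a retract of some open neighbourhood in $Z$), or that, for some integer $n\ge 0$, $X$ has covering dimension $n$ and is $LC^{n-1}$ (that is, for all $0\le k\le n-1$, every neighbourhood $U$ of a point contains a neighbourhood $V$ of that point such that each continuous map of the sphere $S^k$ into $V$ extends to a continuous map of the ball $B^{k+1}$ into $U$). Then: 1. for a generic $f\in C(X,X)$ the set $CR(f)$ is perfect (closed and without isolated points); 2. if $X$ has the weak local periodic point property, i.e. there is a base $\mathcal B$ of open sets of $X$ such that every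 continuous $f:X\to X$ with $f(\overline B)\subset B$ for some $B\in\mathcal B$ has a periodic point in that $B$, then for every integer $l\ge 2$, for a generic $f\in C(X,X)$, the set $CR(f)$ is perfect and $\overline{Per_l(f)}=CR(f)$. -/

import Mathlib

open Set Filter Topology

universe u

namespace GenericCR

/-- A metrizable space `X` is an ANR if, whenever it is embedded as a closed subset of a metrizable
space `Z`, it is a retract of some open neighbourhood in `Z`. -/
def IsANR (X : Type u) [TopologicalSpace X] : Prop :=
  TopologicalSpace.MetrizableSpace X ∧
    ∀ (Z : Type u) [TopologicalSpace Z] [TopologicalSpace.MetrizableSpace Z] (e : X → Z),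
      IsClosedEmbedding e →
        ∃ U : Set Z, IsOpen U ∧ range e ⊆ U ∧
          ∃ r : C(U, X), ∀ (x : X) (hx : e x ∈ U), r ⟨e x, hx⟩ = x

/-- `X` is locally `k`-connected: every neighbourhood `U` of a point contains a neighbourhood `V`
of that point such that each map of the `k`-sphere into `V` extends to a map of the
`(k+1)`-ball into `U`. -/
def LocallyKConnected (X : Type*) [TopologicalSpace X] (k : ℕ) : Prop :=
  ∀ x : X, ∀ U ∈ 𝓝 x, ∃ V ∈ 𝓝 x, V ⊆ U ∧
    ∀ φ : C(Metric.sphere (0 : EuclideanSpace ℝ (Fin (k + 1))) 1, X), (∀ s, φ s ∈ V) →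
      ∃ ψ : C(Metric.closedBall (0 : EuclideanSpace ℝ (Fin (k + 1))) 1, X),
        (∀ b, ψ b ∈ U) ∧ ∀ s, ψ ⟨s.1, Metric.sphere_subset_closedBall s.2⟩ = φ s

/-- `X` is an `LC^m` space: locally `k`-connected for all `0 ≤ k ≤ m` (no condition if `m = -1`). -/
def IsLC (X : Type*) [TopologicalSpace X] (m : ℤ) : Prop :=
  ∀ k : ℕ, (k : ℤ) ≤ m → LocallyKConnected X k

/-- Every finite open cover of `X` has a finite open refinement such that each point lies in at
most `m` of its members; that is, the covering dimension of `X` is at most `m - 1`. -/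
def CoverMultiplicityLE (X : Type*) [TopologicalSpace X] (m : ℕ) : Prop :=
  ∀ 𝒰 : Set (Set X), 𝒰.Finite → (∀ U ∈ 𝒰, IsOpen U) → ⋃₀ 𝒰 = univ →
    ∃ 𝒱 : Set (Set X), 𝒱.Finite ∧ (∀ V ∈ 𝒱, IsOpen V) ∧ ⋃₀ 𝒱 = univ ∧
      (∀ V ∈ 𝒱, ∃ U ∈ 𝒰, V ⊆ U) ∧ ∀ x : X, {V ∈ 𝒱 | x ∈ V}.encard ≤ m

/-- The covering dimension of `X` is exactly `n`. -/
def IsNDimensional (X : Type*) [TopologicalSpace X] (n : ℕ) : Prop :=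
  CoverMultiplicityLE X (n + 1) ∧ ¬ CoverMultiplicityLE X n

/-- There is an `ε`-chain `x = c 0, c 1, …, c n = y` for `f`, with `n ≥ 1`. -/
def HasChain {X : Type*} [MetricSpace X] (f : X → X) (ε : ℝ) (x y : X) : Prop :=
  ∃ (n : ℕ) (c : ℕ → X), 1 ≤ n ∧ c 0 = x ∧ c n = y ∧ ∀ i < n, dist (f (c i)) (c (i + 1)) < ε

/-- The set of chain recurrent points of `f`. -/
def chainRecurrent {X : Type*} [MetricSpace X] (f : X → X) : Set X :=
  {x | ∀ ε : ℝ, 0 < ε → HasChain f ε x x}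

/-- The periodic points of `f` whose orbit has at least `l` elements. -/
def perGE {X : Type*} (f : X → X) (l : ℕ) : Set X :=
  {x | x ∈ Function.periodicPts f ∧ (l : ℕ∞) ≤ (range fun i : ℕ => f^[i] x).encard}

/-- The weak local periodic point property. -/
def WLPPP (X : Type*) [TopologicalSpace X] : Prop :=
  ∃ 𝓑 : Set (Set X), TopologicalSpace.IsTopologicalBasis 𝓑 ∧
    ∀ B ∈ 𝓑, ∀ f : C(X, X), f '' closure B ⊆ B → ∃ x ∈ B, x ∈ Function.periodicPts f

end GenericCR

/-! The graph of `f ↦ CR(f)` is closed, so a Baire category argument over pairs of basic open sets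
reduces both claims to the following: if `x ∈ CR(f)` and `V` is a neighbourhood of `x`, then
arbitrarily close to `f` there is a `g` such that every map near `g` has two chain recurrent
points in `V` (resp. a point of `Per_l` in `V`). Take an `ε`-chain from `x` to itself, traverse
it several times, and move its points slightly so that they become distinct, which is possible
without isolated points. If `f` can be perturbed to a `g` that is locally constant around the
chain and follows it, then small balls around the chain are mapped cyclically, each into the
interior of the next, by `g` and by all maps near `g`. Each ball is then mapped into itself by
an iterate and contains a chain recurrent point, and even a periodic one under the weak local
periodic point property.

The perturbation `g` factors through the nerve of a fine open cover of `X`: the vertices are sent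
to the prescribed values, and this vertex map is extended to the simplices. For an ANR one averages
in a normed space containing `X` and retracts; for an `n`-dimensional `LC^{n-1}` space the nerve
has dimension at most `n`, and one extends over the skeleta one after the other. -/

namespace GenericCR

section Chains

variable {X : Type*} [MetricSpace X]

theorem HasChain.perturb {f f' : X → X} {α β γ δ ε : ℝ} {x x' y y' : X}
    (h : HasChain f' α x' y') (hβ : dist (f x) (f x') ≤ β) (hγ : ∀ z, dist (f z) (f' z) ≤ γ)
    (hδ : dist y' y ≤ δ) (hε : β + γ + α + δ ≤ ε) : HasChain f ε x y := by
  obtain ⟨n, c, hn, rfl, rfl, hc⟩ := h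
  set c' : ℕ → X := fun i => if i = 0 then x else if i = n then y else c i with hc'
  refine ⟨n, c', hn, if_pos rfl, by simp [hc', show n ≠ 0 by omega], fun i hi => ?_⟩
  have hstart : dist (f (c' i)) (f (c i)) ≤ β := by
    rcases eq_or_ne i 0 with rfl | h
    · simpa [hc'] using hβ
    · simpa [hc', h, hi.ne] using dist_nonneg.trans hβ
  have hend : dist (c (i + 1)) (c' (i + 1)) ≤ δ := by
    rcases eq_or_ne (i + 1) n with rfl | h
    · simpa [hc'] using hδ
    · simpa [hc', h] using dist_nonneg.trans hδ
  calc dist (f (c' i)) (c' (i + 1))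
      ≤ dist (f (c' i)) (f (c i)) + dist (f (c i)) (f' (c i)) + dist (f' (c i)) (c (i + 1))
          + dist (c (i + 1)) (c' (i + 1)) :=
        (dist_triangle _ (c (i + 1)) _).trans (by gcongr; exact dist_triangle4 _ _ _ _)
    _ < β + γ + α + δ := by linarith [hc i hi, hγ (c i)]
    _ ≤ ε := hε

theorem hasChain_iterate (f : X → X) {ε : ℝ} (hε : 0 < ε) {n : ℕ} (hn : n ≠ 0) (x : X) :
    HasChain f ε x (f^[n] x) :=
  ⟨n, fun i => f^[i] x, Nat.one_le_iff_ne_zero.2 hn, rfl, rfl, fun i _ => by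
    simpa [Function.iterate_succ_apply'] using hε⟩

theorem periodicPts_subset_chainRecurrent (f : X → X) :
    Function.periodicPts f ⊆ chainRecurrent f := by
  rintro x ⟨n, hn, hx⟩ ε hε
  simpa only [hx.eq] using hasChain_iterate f hε hn.ne' x

theorem exists_mem_chainRecurrent_of_mapsTo {f : X → X} (hf : Continuous f) {K : Set X}
    (hK : IsCompact K) (hne : K.Nonempty) {n : ℕ} (hn : n ≠ 0) (hmaps : MapsTo f^[n] K K) :
    ∃ x ∈ K, x ∈ chainRecurrent f := by
  obtain ⟨y, hy⟩ := hne
  obtain ⟨z, hz, φ, hφ, hlim⟩ := hK.tendsto_subseq fun j => hmaps.iterate j hy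
  refine ⟨z, hz, fun ε hε => ?_⟩
  have hε3 : 0 < ε / 3 := by positivity
  obtain ⟨N, hN⟩ := ((Metric.tendsto_nhds.1 hlim _ hε3).and
    (Metric.tendsto_nhds.1 ((hf.tendsto z).comp hlim) _ hε3)).exists_forall_of_atTop
  have hlt : φ N < φ (N + 1) := hφ N.lt_succ_self
  have hret : f^[n * (φ (N + 1) - φ N)] ((f^[n])^[φ N] y) = (f^[n])^[φ (N + 1)] y := by
    rw [Function.iterate_mul, ← Function.iterate_add_apply, Nat.sub_add_cancel hlt.le]
  have hchain := hasChain_iterate f hε3 (mul_ne_zero hn (Nat.sub_ne_zero_of_lt hlt))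
    ((f^[n])^[φ N] y)
  rw [hret] at hchain
  refine hchain.perturb (β := ε / 3) (γ := 0) (δ := ε / 3) ?_ (by simp) ?_ (by linarith)
  · rw [dist_comm]
    exact (hN N le_rfl).2.le
  · exact (hN (N + 1) N.le_succ).1.le

variable [CompactSpace X]

theorem isClosed_setOf_mem_chainRecurrent :
    IsClosed {p : C(X, X) × X | p.2 ∈ chainRecurrent p.1} := by
  refine isClosed_of_closure_subset fun ⟨f, x⟩ hfx ε hε => ?_
  have hε4 : 0 < ε / 4 := by positivity
  obtain ⟨η, hη, hfη⟩ := Metric.continuousAt_iff.1 f.continuous.continuousAt _ hε4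
  obtain ⟨⟨g, y⟩, hgy, hd⟩ := Metric.mem_closure_iff.1 hfx _ (lt_min hη hε4)
  obtain ⟨hfg, hxy⟩ := max_lt_iff.1 hd
  refine (hgy (ε / 4) hε4).perturb (β := ε / 4) (γ := ε / 4) (δ := ε / 4) ?_ (fun z => ?_) ?_
    (by linarith)
  · rw [dist_comm]
    exact (hfη (by rw [dist_comm]; exact hxy.trans_le (min_le_left _ _))).le
  · exact (ContinuousMap.dist_apply_le_dist z).trans (hfg.le.trans (min_le_right _ _))
  · rw [dist_comm]
    exact hxy.le.trans (min_le_right _ _)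

theorem isClosed_chainRecurrent (f : C(X, X)) : IsClosed (chainRecurrent f) :=
  isClosed_setOf_mem_chainRecurrent.preimage (Continuous.prodMk_right f)

theorem closure_perGE_subset_chainRecurrent (f : C(X, X)) (l : ℕ) :
    closure (perGE f l) ⊆ chainRecurrent f :=
  closure_minimal (fun _ hx => periodicPts_subset_chainRecurrent f hx.1)
    (isClosed_chainRecurrent f)

end Chains

section ClosedGraph

variable {F X : Type*} [TopologicalSpace F] [TopologicalSpace X] [CompactSpace X] {R : F → Set X}

theorem isOpen_setOf_disjoint (hR : IsClosed {p : F × X | p.2 ∈ R p.1}) {K : Set X}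
    (hK : IsClosed K) : IsOpen {f | Disjoint (R f) K} := by
  have himage : {f | Disjoint (R f) K}ᶜ =
      Prod.fst '' ({p : F × X | p.2 ∈ R p.1} ∩ Prod.snd ⁻¹' K) := by
    ext f
    simp [not_disjoint_iff]
  rw [← isClosed_compl_iff, himage]
  exact isClosedMap_fst_of_compactSpace _ (hR.inter (hK.preimage continuous_snd))

theorem eventually_residual_disjoint_or (hR : IsClosed {p : F × X | p.2 ∈ R p.1}) {K : Set X}
    (hK : IsClosed K) {P : F → Prop}
    (hP : ∀ f, ∀ x ∈ R f, x ∈ K → f ∈ closure (interior {g | P g})) :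
    ∀ᶠ f in residual F, Disjoint (R f) K ∨ P f := by
  refine mem_of_superset (residual_of_dense_open
    ((isOpen_setOf_disjoint hR hK).union (isOpen_interior (s := {f | P f}))) fun f => ?_)
    (union_subset_union_right _ interior_subset)
  by_cases hf : Disjoint (R f) K
  · exact subset_closure (Or.inl hf)
  · obtain ⟨x, hx, hxK⟩ := not_disjoint_iff.1 hf
    exact closure_mono subset_union_right (hP f x hx hxK)

theorem eventually_residual_forall_mem_nhds [RegularSpace X] [SecondCountableTopology X]
    (hR : IsClosed {p : F × X | p.2 ∈ R p.1}) {Q : F → Set X → Prop} (hmono : ∀ f, Monotone (Q f))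
    (hQ : ∀ f, ∀ x ∈ R f, ∀ V ∈ 𝓝 x, f ∈ closure (interior {g | Q g V})) :
    ∀ᶠ f in residual F, ∀ x ∈ R f, ∀ V ∈ 𝓝 x, Q f V := by
  obtain ⟨b, hbc, -, hb⟩ := TopologicalSpace.exists_countable_basis X
  have hbasis : ∀ᶠ f in residual F, ∀ U ∈ b, ∀ V ∈ b, closure U ⊆ V →
      Disjoint (R f) (closure U) ∨ Q f V := by
    refine (eventually_countable_ball hbc).2 fun U _ => (eventually_countable_ball hbc).2
      fun V hV => eventually_imp_distrib_left.2 fun hUV => ?_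
    exact eventually_residual_disjoint_or hR isClosed_closure fun f x hx hxU =>
      hQ f x hx V ((hb.isOpen hV).mem_nhds (hUV hxU))
  filter_upwards [hbasis] with f hf x hx W hW
  obtain ⟨V, hV, hxV, hVW⟩ := hb.mem_nhds_iff.1 hW
  obtain ⟨U, hU, hxU, hUV⟩ := hb.exists_closure_subset ((hb.isOpen hV).mem_nhds hxV)
  exact hmono f hVW ((hf U hU V hV hUV).resolve_left
    (not_disjoint_iff.2 ⟨x, hx, subset_closure hxU⟩))

end ClosedGraph

section Polyhedra

variable {ι : Type*} [Fintype ι]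

/-- The carrier of `t`: the vertex set of the smallest face of the standard simplex containing
`t`. -/
noncomputable def carrier (t : ι → ℝ) : Finset ι := {i | t i ≠ 0}

/-- The polyhedron, inside the standard simplex on `ι`, of a simplicial complex `K` given by the
vertex sets of its simplices; `Iic σ` gives the closed simplex spanned by `σ` and `Iio σ` its
boundary. Intended for `IsLowerSet K`. -/
def polyhedron (K : Set (Finset ι)) : Set (ι → ℝ) := {t ∈ stdSimplex ℝ ι | carrier t ∈ K}

theorem carrier_subset_iff {t : ι → ℝ} {σ : Finset ι} : carrier t ⊆ σ ↔ ∀ i ∉ σ, t i = 0 := by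
  simp only [carrier, Finset.subset_iff, Finset.mem_filter_univ, ne_eq, not_imp_comm]

theorem carrier_nonempty {t : ι → ℝ} (ht : t ∈ stdSimplex ℝ ι) :
    (carrier t).Nonempty := by
  obtain ⟨i, -, hi⟩ := Finset.exists_ne_zero_of_sum_ne_zero (ht.2.trans_ne one_ne_zero)
  exact ⟨i, by simpa [carrier] using hi⟩

theorem mem_polyhedron_Iic_carrier {t : ι → ℝ} (ht : t ∈ stdSimplex ℝ ι) :
    t ∈ polyhedron (Iic (carrier t)) :=
  ⟨ht, self_mem_Iic⟩

theorem polyhedron_mono : Monotone (polyhedron : Set (Finset ι) → Set (ι → ℝ)) :=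
  fun _ _ hKL _ ht => ⟨ht.1, hKL ht.2⟩

theorem isClosed_polyhedron_Iic (σ : Finset ι) : IsClosed (polyhedron (Iic σ)) := by
  have h : polyhedron (Iic σ) = stdSimplex ℝ ι ∩ ⋂ i ∉ σ, {t | t i = 0} := by
    ext t
    simp [polyhedron, carrier_subset_iff]
  rw [h]
  exact (isClosed_stdSimplex ℝ ι).inter (isClosed_biInter fun i _ =>
    isClosed_eq (continuous_apply i) continuous_const)

theorem continuousOn_polyhedron {X : Type*} [TopologicalSpace X] {K : Set (Finset ι)}
    (hK : IsLowerSet K) {p : (ι → ℝ) → X} (hp : ∀ σ ∈ K, ContinuousOn p (polyhedron (Iic σ))) :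
    ContinuousOn p (polyhedron K) := by
  have h : polyhedron K = ⋃ σ : K, polyhedron (Iic σ.1) := by
    refine subset_antisymm (fun t ht => mem_iUnion.2 ⟨⟨_, ht.2⟩, mem_polyhedron_Iic_carrier ht.1⟩)
      (iUnion_subset fun σ => polyhedron_mono (hK.Iic_subset σ.2))
  rw [h]
  exact (locallyFinite_of_finite _).continuousOn_iUnion (fun σ => isClosed_polyhedron_Iic σ.1)
    fun σ => hp σ.1 σ.2

theorem exists_continuousOn_polyhedron_extension {X : Type*} [TopologicalSpace X]
    {K L : Set (Finset ι)} (hL : IsLowerSet L) (hK : IsLowerSet K)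
    (hKL : ∀ σ ∈ K \ L, Iio σ ⊆ L) {p : (ι → ℝ) → X} (hp : ContinuousOn p (polyhedron L))
    {q : Finset ι → (ι → ℝ) → X} (hq : ∀ σ ∈ K \ L, ContinuousOn (q σ) (polyhedron (Iic σ)))
    (hqp : ∀ σ ∈ K \ L, EqOn (q σ) p (polyhedron (Iio σ))) :
    ∃ r : (ι → ℝ) → X, ContinuousOn r (polyhedron K) ∧ EqOn r p (polyhedron L) ∧
      ∀ σ ∈ K \ L, EqOn r (q σ) (polyhedron (Iic σ)) := by
  classical
  set r : (ι → ℝ) → X := fun t => if carrier t ∈ L then p t else q (carrier t) t with hr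
  have hrp : EqOn r p (polyhedron L) := fun t ht => if_pos ht.2
  have hrq : ∀ σ ∈ K \ L, EqOn r (q σ) (polyhedron (Iic σ)) := by
    intro σ hσ t ht
    rcases (show carrier t ≤ σ from ht.2).eq_or_lt with h | h
    · simp only [hr, h, if_neg hσ.2]
    · rw [hqp σ hσ ⟨ht.1, h⟩, hrp ⟨ht.1, hKL σ hσ h⟩]
  refine ⟨r, continuousOn_polyhedron hK fun σ hσ => ?_, hrp, hrq⟩
  by_cases h : σ ∈ L
  · have hsub : polyhedron (Iic σ) ⊆ polyhedron L := polyhedron_mono (hL.Iic_subset h)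
    exact (hp.mono hsub).congr (hrp.mono hsub)
  · exact (hq σ ⟨hσ, h⟩).congr (hrq σ ⟨hσ, h⟩)

/-- Barycentric coordinates identify the standard simplex with the convex hull of an affine
basis. -/
noncomputable def stdSimplexHomeomorphConvexHull {E : Type*} [NormedAddCommGroup E]
    [NormedSpace ℝ E] [FiniteDimensional ℝ E] (b : AffineBasis ι ℝ E) :
    stdSimplex ℝ ι ≃ₜ convexHull ℝ (range b) where
  toFun t := ⟨∑ i, t.1 i • b i, (convex_convexHull ℝ _).sum_mem (fun i _ => t.2.1 i) t.2.2
    fun i _ => subset_convexHull ℝ _ (mem_range_self i)⟩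
  invFun x := ⟨fun i => b.coord i x, (b.convexHull_eq_nonneg_coord.subset x.2 :),
    b.sum_coord_apply_eq_one _⟩
  left_inv t := by
    ext i
    have h := b.coord_apply_combination_of_mem (Finset.mem_univ i) t.2.2
    rwa [Finset.affineCombination_eq_linear_combination _ _ _ t.2.2] at h
  right_inv x := Subtype.ext (b.linear_combination_coord_eq_self _)
  continuous_toFun := .subtype_mk ((by fun_prop : Continuous fun t : ι → ℝ => ∑ i, t i • b i).comp
    continuous_subtype_val) _
  continuous_invFun := by
    have := continuous_barycentric_coord b
    exact .subtype_mk (by fun_prop) _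

theorem exists_homeomorph_stdSimplex_closedBall {E : Type*} [NormedAddCommGroup E]
    [NormedSpace ℝ E] [FiniteDimensional ℝ E] (hι : Fintype.card ι = Module.finrank ℝ E + 1) :
    ∃ h : stdSimplex ℝ ι ≃ₜ Metric.closedBall (0 : E) 1,
      ∀ t, (h t : E) ∈ Metric.sphere 0 1 ↔ ∃ i, t.1 i = 0 := by
  obtain ⟨b⟩ : Nonempty (AffineBasis ι ℝ E) :=
    AffineBasis.exists_affineBasis_of_finiteDimensional hι
  have hclosed : IsClosed (convexHull ℝ (range b)) :=
    (finite_range b).isClosed_convexHull ℝ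
  obtain ⟨h, -, hball, hsphere⟩ := exists_homeomorph_image_interior_closure_frontier_eq_unitBall
    (convex_convexHull ℝ (range b)) ⟨_, b.centroid_mem_interior_convexHull⟩
    (isBounded_convexHull.2 (finite_range b).isBounded)
  rw [hclosed.closure_eq] at hball
  refine ⟨((stdSimplexHomeomorphConvexHull b).trans (h.image _)).trans (.setCongr hball),
    fun t => ?_⟩
  have ht := ((stdSimplexHomeomorphConvexHull b) t).2
  have hcoord (i : ι) : b.coord i (stdSimplexHomeomorphConvexHull b t) = t.1 i :=
    congrFun (congrArg Subtype.val ((stdSimplexHomeomorphConvexHull b).symm_apply_apply t)) i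
  change h (stdSimplexHomeomorphConvexHull b t) ∈ _ ↔ _
  rw [← hsphere, h.injective.mem_set_image, hclosed.frontier_eq, b.interior_convexHull]
  simp only [Set.mem_sdiff, ht, true_and, mem_ofPred_eq, hcoord, not_forall, not_lt]
  exact exists_congr fun i => (t.2.1 i).ge_iff_eq'

/-- The closed simplex spanned by `σ` is the standard simplex on `σ`. -/
noncomputable def stdSimplexHomeomorphPolyhedron (σ : Finset ι) :
    stdSimplex ℝ σ ≃ₜ polyhedron (Iic σ) where
  toFun s := ⟨Function.extend Subtype.val s.1 0, by
    have hzero : ∀ i ∉ σ, Function.extend Subtype.val s.1 (0 : ι → ℝ) i = 0 := fun i hi =>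
      Function.extend_apply' _ _ _ (by simpa using hi)
    refine ⟨⟨fun i => ?_, ?_⟩, carrier_subset_iff.2 hzero⟩
    · by_cases hi : i ∈ σ
      · exact (s.2.1 ⟨i, hi⟩).trans_eq (Subtype.val_injective.extend_apply s.1 0 ⟨i, hi⟩).symm
      · exact (hzero i hi).ge
    · rw [← Finset.sum_subset σ.subset_univ fun i _ => hzero i, ← Finset.sum_coe_sort]
      simpa only [Subtype.val_injective.extend_apply] using s.2.2⟩
  invFun t := ⟨fun i => t.1 i, fun i => t.2.1.1 i, by
    rw [Finset.sum_coe_sort σ t.1, Finset.sum_subset σ.subset_univ fun i _ =>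
      carrier_subset_iff.1 t.2.2 i]
    exact t.2.1.2⟩
  left_inv s := Subtype.ext <| funext fun i => Subtype.val_injective.extend_apply _ _ i
  right_inv t := by
    ext i
    by_cases hi : i ∈ σ
    · exact Subtype.val_injective.extend_apply (fun j : σ => t.1 j) 0 ⟨i, hi⟩
    · exact (Function.extend_apply' _ _ _ (by simpa using hi)).trans
        (carrier_subset_iff.1 t.2.2 i hi).symm
  continuous_toFun := by
    refine .subtype_mk (continuous_pi fun i => ?_) _
    by_cases hi : i ∈ σ
    · exact ((continuous_apply (⟨i, hi⟩ : σ)).comp continuous_subtype_val).congr fun s =>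
        (Subtype.val_injective.extend_apply s.1 0 ⟨i, hi⟩).symm
    · exact continuous_const.congr fun s =>
        (Function.extend_apply' s.1 (0 : ι → ℝ) i (by simpa using hi)).symm
  continuous_invFun := .subtype_mk ((by fun_prop : Continuous fun (t : ι → ℝ) (i : σ) => t i).comp
    continuous_subtype_val) _

theorem exists_homeomorph_polyhedron_closedBall {E : Type*} [NormedAddCommGroup E]
    [NormedSpace ℝ E] [FiniteDimensional ℝ E] {σ : Finset ι}
    (hσ : σ.card = Module.finrank ℝ E + 1) :
    ∃ h : polyhedron (Iic σ) ≃ₜ Metric.closedBall (0 : E) 1,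
      ∀ t, (h t : E) ∈ Metric.sphere 0 1 ↔ t.1 ∈ polyhedron (Iio σ) := by
  obtain ⟨h, hh⟩ := exists_homeomorph_stdSimplex_closedBall (ι := σ) (E := E) (by simpa using hσ)
  refine ⟨(stdSimplexHomeomorphPolyhedron σ).symm.trans h, fun t => (hh _).trans ?_⟩
  have hlt : carrier t.1 < σ ↔ ∃ i ∈ σ, i ∉ carrier t.1 :=
    Finset.ssubset_iff_of_subset t.2.2
  change (∃ i : σ, t.1 i = 0) ↔ t.1 ∈ stdSimplex ℝ ι ∧ carrier t.1 < σ
  rw [hlt]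
  simp [t.2.1, carrier]

theorem exists_extension_polyhedron_Iic {X : Type*} [TopologicalSpace X] {k : ℕ} {U V : Set X}
    (hUV : ∀ φ : C(Metric.sphere (0 : EuclideanSpace ℝ (Fin (k + 1))) 1, X), (∀ s, φ s ∈ V) →
      ∃ ψ : C(Metric.closedBall (0 : EuclideanSpace ℝ (Fin (k + 1))) 1, X),
        (∀ b, ψ b ∈ U) ∧ ∀ s, ψ ⟨s.1, Metric.sphere_subset_closedBall s.2⟩ = φ s)
    {σ : Finset ι} (hσ : σ.card = k + 2) {p : (ι → ℝ) → X}
    (hp : ContinuousOn p (polyhedron (Iio σ))) (hpV : MapsTo p (polyhedron (Iio σ)) V) :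
    ∃ q : (ι → ℝ) → X, ContinuousOn q (polyhedron (Iic σ)) ∧
      MapsTo q (polyhedron (Iic σ)) U ∧ EqOn q p (polyhedron (Iio σ)) := by
  obtain ⟨h, hh⟩ := exists_homeomorph_polyhedron_closedBall (σ := σ)
    (E := EuclideanSpace ℝ (Fin (k + 1))) (by simpa using hσ)
  set j : Metric.sphere (0 : EuclideanSpace ℝ (Fin (k + 1))) 1 → polyhedron (Iic σ) :=
    fun s => h.symm ⟨s.1, Metric.sphere_subset_closedBall s.2⟩ with hj
  have hjσ (s) : (j s).1 ∈ polyhedron (Iio σ) := (hh _).1 (by simp [hj])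
  have hjc : Continuous fun s => (j s).1 := by fun_prop
  obtain ⟨ψ, hψU, hψ⟩ := hUV ⟨fun s => p (j s), hp.comp_continuous hjc hjσ⟩ fun s => hpV (hjσ s)
  have hext (t : polyhedron (Iic σ)) : Function.extend Subtype.val (ψ ∘ h) p t = ψ (h t) :=
    Subtype.val_injective.extend_apply _ _ _
  refine ⟨Function.extend Subtype.val (ψ ∘ h) p, ?_, fun t ht => ?_, fun t ht => ?_⟩
  · rw [continuousOn_iff_continuous_domRestrict]
    exact (ψ.continuous.comp h.continuous).congr fun t => (hext t).symm
  · rw [hext ⟨t, ht⟩]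
    exact hψU _
  · have ht' : t ∈ polyhedron (Iic σ) := polyhedron_mono Iio_subset_Iic_self ht
    rw [hext ⟨t, ht'⟩]
    simpa [hj] using hψ ⟨h ⟨t, ht'⟩, (hh _).2 ht⟩

end Polyhedra

section SimplicialExtension

/-- Extension of vertex maps: a map `v` of the vertices of a finite simplicial complex `K` of
dimension less than `m` that sends each simplex to a set of small diameter extends continuously to
the polyhedron of `K`, with each point sent close to the images of the vertices of its carrier. -/
def HasSimplicialExtension (X : Type u) [MetricSpace X] (m : ℕ∞) : Prop :=
  ∀ ε : ℝ, 0 < ε → ∃ δ : ℝ, 0 < δ ∧ ∀ (ι : Type u) [Fintype ι] [Nonempty ι] (K : Set (Finset ι)),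
    IsLowerSet K → (∀ σ ∈ K, (σ.card : ℕ∞) ≤ m) → ∀ v : ι → X,
      (∀ σ ∈ K, ∀ i ∈ σ, ∀ j ∈ σ, dist (v i) (v j) < δ) →
      ∃ p : (ι → ℝ) → X, ContinuousOn p (polyhedron K) ∧ ∀ t ∈ polyhedron K,
        (∀ i ∈ carrier t, dist (p t) (v i) < ε) ∧ ∀ i, carrier t = {i} → p t = v i

theorem IsANR.exists_continuousOn_retraction {X : Type u} [TopologicalSpace X] [Nonempty X]
    (hX : IsANR X) {Z : Type u} [TopologicalSpace Z] [TopologicalSpace.MetrizableSpace Z]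
    {e : X → Z} (he : IsClosedEmbedding e) :
    ∃ (r : Z → X) (U : Set Z), IsOpen U ∧ range e ⊆ U ∧ ContinuousOn r U ∧ ∀ x, r (e x) = x := by
  obtain ⟨U, hU, heU, r, hr⟩ := hX.2 Z e he
  have hext (z : U) : Function.extend Subtype.val r (fun _ => Classical.arbitrary X) z = r z :=
    Subtype.val_injective.extend_apply _ _ _
  refine ⟨Function.extend Subtype.val r fun _ => Classical.arbitrary X, U, hU, heU, ?_,
    fun x => (hext ⟨e x, heU (mem_range_self x)⟩).trans (hr x _)⟩
  rw [continuousOn_iff_continuous_domRestrict]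
  exact r.continuous.congr fun z => (hext z).symm

variable {X : Type u} [MetricSpace X] [CompactSpace X]

theorem IsANR.exists_uniform_retraction [Nonempty X] (hX : IsANR X) {Z : Type u} [MetricSpace Z]
    {e : X → Z} (he : IsClosedEmbedding e) :
    ∃ r : Z → X, (∀ x, r (e x) = x) ∧ ∀ ε : ℝ, 0 < ε → ∃ δ : ℝ, 0 < δ ∧ ∀ x z,
      dist (e x) z < δ → ContinuousAt r z ∧ dist x (r z) < ε := by
  obtain ⟨r, U, hU, heU, hrU, hre⟩ := hX.exists_continuousOn_retraction he
  have hcompact : IsCompact (range e) := isCompact_range he.continuous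
  have hr : ∀ z ∈ U, ContinuousAt r z := fun z hz => hrU.continuousAt (hU.mem_nhds hz)
  refine ⟨r, hre, fun ε hε => ?_⟩
  obtain ⟨δ₁, hδ₁, hthick⟩ := hcompact.exists_thickening_subset_open hU heU
  obtain ⟨δ₂, hδ₂, hunif⟩ := Metric.mem_uniformity_dist.1 <|
    hcompact.uniformContinuousAt_of_continuousAt r (fun z hz => hr z (heU hz))
      (Metric.dist_mem_uniformity hε)
  refine ⟨min δ₁ δ₂, lt_min hδ₁ hδ₂, fun x z hz => ⟨hr z (hthick ?_), ?_⟩⟩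
  · rw [dist_comm] at hz
    exact Metric.mem_thickening_iff.2 ⟨e x, mem_range_self x, hz.trans_le (min_le_left _ _)⟩
  · simpa only [mem_ofPred_eq, hre] using
      hunif (hz.trans_le (min_le_right _ _)) (mem_range_self x)

theorem IsANR.hasSimplicialExtension_of_isometry (hX : IsANR X) {E : Type u}
    [NormedAddCommGroup E] [NormedSpace ℝ E] {e : X → E} (he : Isometry e) :
    HasSimplicialExtension X ⊤ := by
  intro ε hε
  rcases isEmpty_or_nonempty X with hX₀ | hX₀
  · exact ⟨1, one_pos, fun ι _ _ K _ _ v => isEmptyElim (v (Classical.arbitrary ι))⟩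
  obtain ⟨r, hre, hr⟩ := hX.exists_uniform_retraction he.isClosedEmbedding
  obtain ⟨δ, hδ, hrδ⟩ := hr ε hε
  refine ⟨δ, hδ, fun ι _ _ K _ _ v hv => ?_⟩
  let s : (ι → ℝ) → E := fun t => ∑ j, t j • e (v j)
  have hs : Continuous s := by fun_prop
  have hnear : ∀ t ∈ polyhedron K, ∀ i ∈ carrier t, dist (e (v i)) (s t) < δ := by
    intro t ht i hi
    rw [dist_comm, ← Metric.mem_ball, show s t = _ from (finsum_eq_sum_of_fintype _).symm]
    refine (convex_ball _ _).finsum_mem ht.1.1 ((finsum_eq_sum_of_fintype t).trans ht.1.2)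
      fun j hj => ?_
    rw [Metric.mem_ball, he.dist_eq]
    exact hv _ ht.2 j (by simpa [carrier] using hj) i hi
  refine ⟨r ∘ s, fun t ht => ?_,
    fun t ht => ⟨fun i hi => ?_, fun i hi => ?_⟩⟩
  · obtain ⟨i, hi⟩ := carrier_nonempty ht.1
    exact ((hrδ _ _ (hnear t ht i hi)).1.comp hs.continuousAt).continuousWithinAt
  · rw [dist_comm]
    exact (hrδ _ _ (hnear t ht i hi)).2
  · have hzero : ∀ j ≠ i, t j = 0 := fun j hj =>
      carrier_subset_iff.1 hi.subset j (by simpa using hj)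
    have hone : t i = 1 := by
      rw [← ht.1.2, Fintype.sum_eq_single i hzero]
    change r (∑ j, t j • e (v j)) = v i
    rw [Fintype.sum_eq_single i fun j hj => by rw [hzero j hj, zero_smul], hone, one_smul, hre]

theorem IsANR.hasSimplicialExtension (hX : IsANR X) : HasSimplicialExtension X ⊤ :=
  hX.hasSimplicialExtension_of_isometry
    (e := fun x => ULift.up.{u} (kuratowskiEmbedding X x))
    (Isometry.of_dist_eq (kuratowskiEmbedding.isometry X).dist_eq)

theorem LocallyKConnected.exists_forall_extension {k : ℕ} (hX : LocallyKConnected X k) {ε : ℝ}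
    (hε : 0 < ε) : ∃ δ : ℝ, 0 < δ ∧ ∀ x : X,
      ∀ φ : C(Metric.sphere (0 : EuclideanSpace ℝ (Fin (k + 1))) 1, X),
        (∀ s, φ s ∈ Metric.ball x δ) →
        ∃ ψ : C(Metric.closedBall (0 : EuclideanSpace ℝ (Fin (k + 1))) 1, X),
          (∀ b, ψ b ∈ Metric.ball x ε) ∧
            ∀ s, ψ ⟨s.1, Metric.sphere_subset_closedBall s.2⟩ = φ s := by
  choose V hV hVU hext using fun x : X =>
    hX x (Metric.ball x (ε / 2)) (Metric.ball_mem_nhds x (by positivity))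
  obtain ⟨δ, hδ, hδV⟩ := Metric.uniformity_basis_dist.lebesgue_number_lemma_nhds
    (isCompact_univ (X := X)) fun x _ => hV x
  refine ⟨δ, hδ, fun x φ hφ => ?_⟩
  obtain ⟨y, hy⟩ := hδV x (mem_univ x)
  obtain ⟨ψ, hψ, hψφ⟩ := hext y φ fun s => hy (Metric.mem_ball'.1 (hφ s))
  have hxy : dist x y < ε / 2 := hVU y (hy ((dist_self x).trans_lt hδ))
  exact ⟨ψ, fun b => (dist_triangle_right _ _ y).trans_lt
    ((add_lt_add (hψ b) hxy).trans_eq (add_halves ε)), hψφ⟩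

theorem hasSimplicialExtension_one (X : Type u) [MetricSpace X] : HasSimplicialExtension X 1 := by
  refine fun ε hε => ⟨1, one_pos, fun ι _ _ K hK hcard v _ => ?_⟩
  set p : (ι → ℝ) → X := fun t => v (Classical.epsilon (· ∈ carrier t))
  have hvertex : ∀ t i, carrier t = {i} → p t = v i := by
    intro t i hi
    have hmem := Classical.epsilon_spec (p := (· ∈ carrier t)) ⟨i, by simp [hi]⟩
    exact congrArg v (Finset.mem_singleton.1 (hi.subset hmem))
  have hsingleton : ∀ σ ∈ K, ∀ t ∈ polyhedron (Iic σ), ∀ i ∈ σ, carrier t = {i} := by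
    intro σ hσ t ht i hi
    have hσi : σ = {i} := Finset.eq_singleton_iff_unique_mem.2
      ⟨hi, fun j hj => Finset.card_le_one.1 (by exact_mod_cast hcard σ hσ) j hj i hi⟩
    exact (carrier_nonempty ht.1).subset_singleton_iff.1
      ((show carrier t ⊆ σ from ht.2).trans_eq hσi)
  refine ⟨p, continuousOn_polyhedron hK fun σ hσ => ?_, fun t ht => ⟨fun i hi => ?_, hvertex t⟩⟩
  · rcases (polyhedron (Iic σ)).eq_empty_or_nonempty with h | ⟨s, hs⟩
    · exact h ▸ continuousOn_empty p
    · obtain ⟨i, hi⟩ := carrier_nonempty hs.1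
      exact continuousOn_const.congr fun t ht => hvertex t i (hsingleton σ hσ t ht i (hs.2 hi))
  · rwa [hvertex t i (hsingleton _ ht.2 t (mem_polyhedron_Iic_carrier ht.1) i hi), dist_self]

theorem LocallyKConnected.exists_extension_simplex {n : ℕ} (hX : LocallyKConnected X n) {ε : ℝ}
    (hε : 0 < ε) : ∃ δ : ℝ, 0 < δ ∧ ∀ (ι : Type u) [Fintype ι] (σ : Finset ι), σ.card = n + 2 →
      ∀ v : ι → X, (∀ i ∈ σ, ∀ j ∈ σ, dist (v i) (v j) < δ) →
      ∀ p : (ι → ℝ) → X, ContinuousOn p (polyhedron (Iio σ)) →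
        (∀ t ∈ polyhedron (Iio σ), ∀ i ∈ carrier t, dist (p t) (v i) < δ) →
        ∃ q : (ι → ℝ) → X, ContinuousOn q (polyhedron (Iic σ)) ∧ EqOn q p (polyhedron (Iio σ)) ∧
          ∀ t ∈ polyhedron (Iic σ), ∀ i ∈ σ, dist (q t) (v i) < ε := by
  obtain ⟨η, hη, hsphere⟩ := hX.exists_forall_extension (half_pos hε)
  refine ⟨min (η / 2) (ε / 2), by positivity, fun ι _ σ hσ v hv p hp hpv => ?_⟩
  simp only [lt_min_iff] at hv hpv
  obtain ⟨i₀, hi₀⟩ : σ.Nonempty := Finset.card_pos.1 (by omega)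
  obtain ⟨q, hq, hqv, hqp⟩ := exists_extension_polyhedron_Iic (hsphere (v i₀)) hσ hp
    fun t ht => by
      obtain ⟨i, hi⟩ := carrier_nonempty ht.1
      have hiσ : i ∈ σ := (show carrier t < σ from ht.2).le hi
      exact (dist_triangle _ (v i) _).trans_lt
        ((add_lt_add (hpv t ht i hi).1 (hv i hiσ i₀ hi₀).1).trans_eq (add_halves η))
  exact ⟨q, hq, hqp, fun t ht i hi => (dist_triangle _ (v i₀) _).trans_lt
    ((add_lt_add (hqv ht) (hv i₀ hi₀ i hi).2).trans_eq (add_halves ε))⟩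

theorem HasSimplicialExtension.succ {n : ℕ} (h : HasSimplicialExtension X (n + 1 : ℕ))
    (hn : LocallyKConnected X n) : HasSimplicialExtension X (n + 2 : ℕ) := by
  intro ε hε
  obtain ⟨δ₁, hδ₁, hcell⟩ := hn.exists_extension_simplex hε
  obtain ⟨δ₀, hδ₀, hskel⟩ := h (min δ₁ ε) (by positivity)
  refine ⟨min δ₀ δ₁, by positivity, fun ι _ _ K hK hcard v hv => ?_⟩
  simp only [lt_min_iff] at hv
  have hX₀ : Nonempty X := ⟨v (Classical.arbitrary ι)⟩
  set L : Set (Finset ι) := {σ ∈ K | σ.card ≤ n + 1}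
  have hLlower : IsLowerSet L := fun σ τ hτσ hσ =>
    ⟨hK hτσ hσ.1, (Finset.card_le_card hτσ).trans hσ.2⟩
  have hcardL : ∀ σ ∈ K \ L, σ.card = n + 2 := fun σ hσ =>
    le_antisymm (by exact_mod_cast hcard σ hσ.1) (not_le.1 fun h => hσ.2 ⟨hσ.1, h⟩)
  have hKL : ∀ σ ∈ K \ L, Iio σ ⊆ L := fun σ hσ τ hτ =>
    ⟨hK hτ.le hσ.1, Nat.le_of_lt_succ ((Finset.card_lt_card hτ).trans_eq (hcardL σ hσ))⟩
  obtain ⟨p, hp, hpv⟩ := hskel ι L hLlower (fun σ hσ => by exact_mod_cast hσ.2) v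
    fun σ hσ i hi j hj => (hv σ hσ.1 i hi j hj).1
  simp only [lt_min_iff] at hpv
  have hfill : ∀ σ ∈ K \ L, ∃ q : (ι → ℝ) → X, ContinuousOn q (polyhedron (Iic σ)) ∧
      EqOn q p (polyhedron (Iio σ)) ∧
      ∀ t ∈ polyhedron (Iic σ), ∀ i ∈ σ, dist (q t) (v i) < ε := by
    intro σ hσ
    have hsub : polyhedron (Iio σ) ⊆ polyhedron L := polyhedron_mono (hKL σ hσ)
    exact hcell ι σ (hcardL σ hσ) v (fun i hi j hj => (hv σ hσ.1 i hi j hj).2) p (hp.mono hsub)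
      fun t ht i hi => ((hpv t (hsub ht)).1 i hi).1
  choose! q hq hqp hqv using hfill
  obtain ⟨r, hr, hrp, hrq⟩ := exists_continuousOn_polyhedron_extension hLlower hK hKL hp hq hqp
  refine ⟨r, hr, fun t ht => ?_⟩
  by_cases htL : carrier t ∈ L
  · rw [hrp ⟨ht.1, htL⟩]
    exact ⟨fun i hi => ((hpv t ⟨ht.1, htL⟩).1 i hi).2, (hpv t ⟨ht.1, htL⟩).2⟩
  · have htσ := mem_polyhedron_Iic_carrier ht.1
    rw [hrq _ ⟨ht.2, htL⟩ htσ]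
    refine ⟨hqv _ ⟨ht.2, htL⟩ t htσ, fun i hi => ?_⟩
    exact absurd (hcardL _ ⟨ht.2, htL⟩) (by simp [hi])

theorem hasSimplicialExtension_of_locallyKConnected (n : ℕ)
    (hX : ∀ k < n, LocallyKConnected X k) : HasSimplicialExtension X (n + 1 : ℕ) := by
  induction n with
  | zero => exact_mod_cast hasSimplicialExtension_one X
  | succ n ih => exact (ih fun k hk => hX k (hk.trans n.lt_succ_self)).succ (hX n n.lt_succ_self)

end SimplicialExtension

section Perturbation

/-- Any choice of neighbourhoods of the points of `Y` is refined by a finite open cover of `Y` each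
point of which lies in at most `m` members. For compact `Y` and `m = n + 1` this says that the
covering dimension of `Y` is at most `n`. -/
def HasFiniteRefinements (Y : Type u) [TopologicalSpace Y] (m : ℕ∞) : Prop :=
  ∀ U : Y → Set Y, (∀ y, U y ∈ 𝓝 y) → ∃ (ι : Type u) (_ : Finite ι) (V : ι → Set Y),
    (∀ i, IsOpen (V i)) ∧ ⋃ i, V i = univ ∧ (∀ i, ∃ y, V i ⊆ U y) ∧
      ∀ y, {i | y ∈ V i}.encard ≤ m

theorem hasFiniteRefinements_top (Y : Type u) [TopologicalSpace Y] [CompactSpace Y] :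
    HasFiniteRefinements Y ⊤ := by
  intro U hU
  obtain ⟨t, ht⟩ := CompactSpace.elim_nhds_subcover (fun y => interior (U y))
    fun y => interior_mem_nhds.2 (hU y)
  refine ⟨t, inferInstance, fun y => interior (U y), fun _ => isOpen_interior, ?_,
    fun y => ⟨y, interior_subset⟩, fun _ => le_top⟩
  exact (biUnion_eq_iUnion (t : Set Y) fun y _ => interior (U y)).symm.trans ht

theorem CoverMultiplicityLE.hasFiniteRefinements {Y : Type u} [TopologicalSpace Y]
    [CompactSpace Y] {m : ℕ} (hY : CoverMultiplicityLE Y m) : HasFiniteRefinements Y m := by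
  intro U hU
  obtain ⟨t, ht⟩ := CompactSpace.elim_nhds_subcover (fun y => interior (U y))
    fun y => interior_mem_nhds.2 (hU y)
  obtain ⟨𝒱, hfin, hopen, hcover, hsub, hmult⟩ := hY ((fun y => interior (U y)) '' t)
    (t.finite_toSet.image _) (forall_mem_image.2 fun _ _ => isOpen_interior)
    (by rwa [sUnion_image])
  refine ⟨𝒱, hfin, Subtype.val, fun V => hopen V V.2, by rwa [← sUnion_eq_iUnion], fun V => ?_,
    fun y => ?_⟩
  · obtain ⟨-, ⟨y, -, rfl⟩, hVU⟩ := hsub V V.2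
    exact ⟨y, hVU.trans interior_subset⟩
  · refine (Subtype.val_injective.encard_image _).symm.trans_le
      ((encard_le_encard ?_).trans (hmult y))
    rintro - ⟨V, hV, rfl⟩
    exact ⟨V.2, hV⟩

theorem exists_partitionOfUnity_eventually_eq_zero {Y ι : Type*} [TopologicalSpace Y]
    [NormalSpace Y] [T1Space Y] [Finite ι] {V : ι → Set Y} (hV : ∀ i, IsOpen (V i))
    (hcover : ⋃ i, V i = univ) {s : Set Y} (hs : s.Finite) :
    ∃ φ : PartitionOfUnity ι Y univ, φ.IsSubordinate V ∧
      ∀ a ∈ s, ∃ i, a ∈ V i ∧ ∀ᶠ y in 𝓝 a, ∀ j ≠ i, φ j y = 0 := by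
  choose W hW using fun a => mem_iUnion.1 (hcover.ge (mem_univ a))
  obtain ⟨φ, hφ⟩ := PartitionOfUnity.exists_isSubordinate_of_locallyFinite isClosed_univ
    (fun i => V i \ {a ∈ s | W a ≠ i})
    (fun i => (hV i).sdiff (hs.subset (sep_subset _ _)).isClosed) (locallyFinite_of_finite _)
    fun a _ => mem_iUnion.2 ⟨W a, hW a, fun h => h.2 rfl⟩
  refine ⟨φ, fun i => (hφ i).trans Set.sdiff_subset, fun a ha => ⟨W a, hW a, ?_⟩⟩
  refine eventually_all.2 fun j => eventually_imp_distrib_left.2 fun hj => ?_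
  have haj : a ∉ tsupport (φ j) := fun h => (hφ j h).2 ⟨ha, hj.symm⟩
  exact notMem_tsupport_iff_eventuallyEq.1 haj

/-- The nerve of an indexed cover, as the set of vertex sets of its simplices. -/
def nerve {ι Y : Type*} (V : ι → Set Y) : Set (Finset ι) := {σ | (⋂ i ∈ σ, V i).Nonempty}

theorem isLowerSet_nerve {ι Y : Type*} (V : ι → Set Y) : IsLowerSet (nerve V) :=
  fun _ _ hτσ hσ => hσ.mono (biInter_subset_biInter_left hτσ)

theorem exists_continuous_polyhedron_nerve {Y ι : Type*} [TopologicalSpace Y] [NormalSpace Y]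
    [T1Space Y] [Fintype ι] {V : ι → Set Y} (hV : ∀ i, IsOpen (V i)) (hcover : ⋃ i, V i = univ)
    {s : Set Y} (hs : s.Finite) :
    ∃ N : Y → ι → ℝ, Continuous N ∧ (∀ y, N y ∈ polyhedron (nerve V)) ∧
      (∀ y, ∀ i ∈ carrier (N y), y ∈ V i) ∧
      ∀ a ∈ s, ∃ i, a ∈ V i ∧ ∀ᶠ y in 𝓝 a, carrier (N y) = {i} := by
  obtain ⟨φ, hφV, hφs⟩ := exists_partitionOfUnity_eventually_eq_zero hV hcover hs
  have hsimplex (y) : (fun i => φ i y) ∈ stdSimplex ℝ ι := ⟨fun i => φ.nonneg i y, by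
    rw [← finsum_eq_sum_of_fintype]
    exact φ.sum_eq_one (mem_univ y)⟩
  have hcarrier : ∀ y, ∀ i ∈ carrier (fun i => φ i y), y ∈ V i := fun y i hi =>
    hφV i (subset_tsupport _ (by simpa [carrier] using hi))
  refine ⟨fun y i => φ i y, by fun_prop, fun y => ⟨hsimplex y, y, ?_⟩, hcarrier, fun a ha => ?_⟩
  · simpa only [mem_iInter] using hcarrier y
  · obtain ⟨i, hai, hi⟩ := hφs a ha
    refine ⟨i, hai, hi.mono fun y hy => ?_⟩
    exact (carrier_nonempty (hsimplex y)).subset_singleton_iff.1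
      (carrier_subset_iff.2 fun j hj => hy j (by simpa using hj))

theorem HasFiniteRefinements.exists_map_to_polyhedron {Y : Type u} [TopologicalSpace Y]
    [NormalSpace Y] [T1Space Y] [Nonempty Y] {m : ℕ∞} (hY : HasFiniteRefinements Y m)
    {U : Y → Set Y} (hU : ∀ y, U y ∈ 𝓝 y) {s : Set Y} (hs : s.Finite) :
    ∃ (ι : Type u) (_ : Fintype ι) (_ : Nonempty ι) (K : Set (Finset ι)) (x : ι → Y)
      (N : Y → ι → ℝ), IsLowerSet K ∧ (∀ σ ∈ K, (σ.card : ℕ∞) ≤ m) ∧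
        (∀ σ ∈ K, ∃ y, ∀ i ∈ σ, y ∈ U (x i)) ∧ Continuous N ∧ (∀ y, N y ∈ polyhedron K) ∧
        (∀ y, ∀ i ∈ carrier (N y), y ∈ U (x i)) ∧
        ∀ a ∈ s, ∃ i, x i = a ∧ ∀ᶠ y in 𝓝 a, carrier (N y) = {i} := by
  obtain ⟨ι, hι, V, hVopen, hVcover, hVU, hmult⟩ := hY (fun x => U x ∩ (s \ {x})ᶜ) fun x =>
    inter_mem (hU x) ((hs.subset Set.sdiff_subset).isClosed.isOpen_compl.mem_nhds (by simp))
  choose x hx using hVU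
  obtain ⟨i₀, -⟩ := mem_iUnion.1 (hVcover.ge (mem_univ (Classical.arbitrary Y)))
  have := Fintype.ofFinite ι
  obtain ⟨N, hN, hNnerve, hNV, hNs⟩ := exists_continuous_polyhedron_nerve hVopen hVcover hs
  refine ⟨ι, inferInstance, ⟨i₀⟩, nerve V, x, N, isLowerSet_nerve V, fun σ ⟨y, hy⟩ => ?_,
    fun σ ⟨y, hy⟩ => ⟨y, fun i hi => (hx i (mem_iInter₂.1 hy i hi)).1⟩, hN, hNnerve,
    fun y i hi => (hx i (hNV y i hi)).1, fun a ha => ?_⟩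
  · rw [← encard_coe_eq_coe_finsetCard]
    exact (encard_le_encard fun i hi => mem_iInter₂.1 hy i hi).trans (hmult y)
  · obtain ⟨i, hai, hi⟩ := hNs a ha
    refine ⟨i, ?_, hi⟩
    by_contra h
    exact (hx i hai).2 ⟨ha, fun ha => h ha.symm⟩

/-- Finitely many values of a map can be prescribed, locally constantly, by a small perturbation:
for every `ε` there is `δ` such that, for `f : C(Y, X)`, any values `b a` that are `δ`-close to
`f a` at the points `a` of a finite set are taken near these points by a map `ε`-close to `f`. -/
def PerturbationProperty (Y X : Type*) [TopologicalSpace Y] [MetricSpace X] : Prop :=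
  ∀ ε : ℝ, 0 < ε → ∃ δ : ℝ, 0 < δ ∧ ∀ (f : C(Y, X)) (b : Y → X), (∀ y, dist (b y) (f y) < δ) →
    ∀ s : Set Y, s.Finite →
      ∃ g : C(Y, X), (∀ y, dist (g y) (f y) < ε) ∧ ∀ a ∈ s, ∀ᶠ y in 𝓝 a, g y = b a

theorem HasFiniteRefinements.perturbationProperty {Y X : Type u} [TopologicalSpace Y]
    [NormalSpace Y] [T1Space Y] [MetricSpace X] {m : ℕ∞} (hY : HasFiniteRefinements Y m)
    (hX : HasSimplicialExtension X m) : PerturbationProperty Y X := by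
  intro ε hε
  obtain ⟨δ, hδ, hext⟩ := hX (ε / 2) (half_pos hε)
  set η := min (δ / 2) (ε / 2) with hη
  refine ⟨η / 2, by positivity, fun f b hb s hs => ?_⟩
  rcases isEmpty_or_nonempty Y with hY₀ | hY₀
  · exact ⟨f, isEmptyElim, fun a => isEmptyElim a⟩
  obtain ⟨ι, _, _, K, x, N, hK, hcard, hstar, hN, hNK, hNU, hNs⟩ := hY.exists_map_to_polyhedron
    (fun x => f.continuous.continuousAt (Metric.ball_mem_nhds (f x) (by positivity : 0 < η / 2))) hs
  have hnear : ∀ i, ∀ y ∈ f ⁻¹' Metric.ball (f (x i)) (η / 2), dist (b (x i)) (f y) < η :=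
    fun i y hy => (dist_triangle_right _ _ (f (x i))).trans_lt
      ((add_lt_add (hb (x i)) hy).trans_eq (add_halves η))
  simp only [hη, lt_min_iff] at hnear
  have hsmall : ∀ σ ∈ K, ∀ i ∈ σ, ∀ j ∈ σ, dist (b (x i)) (b (x j)) < δ := by
    intro σ hσ i hi j hj
    obtain ⟨y, hy⟩ := hstar σ hσ
    exact (dist_triangle_right _ _ (f y)).trans_lt
      ((add_lt_add (hnear i y (hy i hi)).1 (hnear j y (hy j hj)).1).trans_eq (add_halves δ))
  obtain ⟨p, hp, hpv⟩ := hext ι K hK hcard (fun i => b (x i)) hsmall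
  refine ⟨⟨fun y => p (N y), hp.comp_continuous hN hNK⟩, fun y => ?_, fun a ha => ?_⟩
  · obtain ⟨i, hi⟩ := carrier_nonempty (hNK y).1
    exact (dist_triangle _ (b (x i)) _).trans_lt ((add_lt_add ((hpv _ (hNK y)).1 i hi)
      (hnear i y (hNU y i hi)).2).trans_eq (add_halves ε))
  · obtain ⟨i, rfl, hi⟩ := hNs a ha
    exact hi.mono fun y hy => (hpv _ (hNK y)).2 i hy

end Perturbation

section Cycles

theorem exists_injective_forall_mem_of_infinite {ι α : Type*} [Finite ι] {S : ι → Set α}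
    (hS : ∀ i, (S i).Infinite) : ∃ a : ι → α, Function.Injective a ∧ ∀ i, a i ∈ S i := by
  classical
  have := Fintype.ofFinite ι
  choose T hTS hT using fun i => (hS i).exists_subset_card_eq (Fintype.card ι)
  obtain ⟨a, ha, haT⟩ := (Finset.all_card_le_biUnion_card_iff_exists_injective T).1 fun s => by
    rcases s.eq_empty_or_nonempty with rfl | ⟨i, hi⟩
    · simp
    · exact (Finset.card_le_univ s).trans
        ((hT i).ge.trans (Finset.card_le_card (Finset.subset_biUnion_of_mem T hi)))
  exact ⟨a, ha, fun i => hTS i (haT i)⟩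

variable {X : Type*} [MetricSpace X]

theorem HasChain.exists_cycle {f : X → X} {ε : ℝ} {x : X} (h : HasChain f ε x x) :
    ∃ n ≠ 0, ∃ c : ZMod n → X, c 0 = x ∧ ∀ i, dist (f (c i)) (c (i + 1)) < ε := by
  obtain ⟨n, c, hn, h0, hcn, hc⟩ := h
  have : NeZero n := ⟨by omega⟩
  refine ⟨n, NeZero.ne n, fun i => c i.val, by simpa using h0, fun i => ?_⟩
  have hsucc : c (i + 1).val = c (i.val + 1) := by
    rw [ZMod.val_add, ZMod.val_one_eq_one_mod, Nat.add_mod_mod]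
    rcases (Nat.succ_le_of_lt i.val_lt).eq_or_lt with hi | hi
    · rw [show i.val + 1 = n from hi, Nat.mod_self, h0, hcn]
    · rw [Nat.mod_eq_of_lt hi]
  simpa only [hsucc] using hc _ i.val_lt

theorem exists_injective_cycle [PerfectSpace X] {f : X → X} (hf : UniformContinuous f) {x : X}
    (hx : x ∈ chainRecurrent f) {V : Set X} (hV : V ∈ 𝓝 x) {ε : ℝ} (hε : 0 < ε) (l : ℕ) :
    ∃ (N : ℕ) (_ : NeZero N) (a : ZMod N → X), l ≤ N ∧ Function.Injective a ∧
      (∀ i, dist (f (a i)) (a (i + 1)) < ε) ∧ a 0 ∈ V ∧ ∃ j ≠ 0, a j ∈ V := by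
  have hε3 : 0 < ε / 3 := by positivity
  obtain ⟨η, hη, hfη⟩ := Metric.uniformContinuous_iff.1 hf _ hε3
  obtain ⟨ρ, hρ, hρV⟩ := Metric.mem_nhds_iff.1 hV
  obtain ⟨n, hn, c, rfl, hc⟩ := (hx _ hε3).exists_cycle
  -- The cycle is traversed `l + 2` times, so that it is long and returns to `V`.
  set N := n * (l + 2) with hN
  have : NeZero N := ⟨by positivity⟩
  let π : ZMod N →+* ZMod n := ZMod.castHom (dvd_mul_right n (l + 2)) (ZMod n)
  have hr : 0 < min (min η ρ) (ε / 3) := by positivity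
  obtain ⟨a, ha, hac⟩ := exists_injective_forall_mem_of_infinite fun i =>
    infinite_of_mem_nhds _ (Metric.ball_mem_nhds (c (π i)) hr)
  simp only [Metric.mem_ball, lt_min_iff] at hac
  have hmemV : ∀ j, π j = 0 → a j ∈ V := fun j hj =>
    hρV (Metric.mem_ball.2 (hj ▸ (hac j).1.2))
  refine ⟨N, this, a, by nlinarith [Nat.pos_of_ne_zero hn], ha, fun i => ?_, hmemV 0 (map_zero π),
    n, fun h => ?_, hmemV n (by simp)⟩
  · have hstep := hc (π i)
    rw [← map_one π, ← map_add] at hstep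
    have hend := (hac (i + 1)).2
    rw [dist_comm] at hend
    linarith [dist_triangle4 (f (a i)) (f (c (π i))) (c (π (i + 1))) (a (i + 1)),
      hfη (hac i).1.1]
  · have := Nat.le_of_dvd (Nat.pos_of_ne_zero hn) ((ZMod.natCast_eq_zero_iff n N).1 h)
    nlinarith [Nat.pos_of_ne_zero hn]

/-- Along the distinct points `a i`, indexed cyclically, `g` is the constant `a (i + 1)` near
`a i`. -/
structure IsLocallyConstantCycle {X : Type*} [TopologicalSpace X] (g : X → X) {N : ℕ}
    (a : ZMod N → X) : Prop where
  injective : Function.Injective a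
  eventually_eq : ∀ i, ∀ᶠ y in 𝓝 (a i), g y = a (i + 1)

theorem PerturbationProperty.exists_isLocallyConstantCycle [CompactSpace X] [PerfectSpace X]
    (hP : PerturbationProperty X X) (f : C(X, X)) {x : X} (hx : x ∈ chainRecurrent f) {V : Set X}
    (hV : V ∈ 𝓝 x) {ε : ℝ} (hε : 0 < ε) (l : ℕ) :
    ∃ g : C(X, X), (∀ y, dist (g y) (f y) < ε) ∧ ∃ (N : ℕ) (_ : NeZero N) (a : ZMod N → X),
      l ≤ N ∧ IsLocallyConstantCycle g a ∧ a 0 ∈ V ∧ ∃ j ≠ 0, a j ∈ V := by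
  obtain ⟨δ, hδ, hpert⟩ := hP ε hε
  obtain ⟨N, hN, a, hlN, ha, hchain, haV⟩ := exists_injective_cycle
    (CompactSpace.uniformContinuous_of_continuous f.continuous) hx hV hδ l
  set b : X → X := Function.extend a (fun i => a (i + 1)) f with hb
  have hba : ∀ i, b (a i) = a (i + 1) := ha.extend_apply _ _
  have hbf : ∀ y, dist (b y) (f y) < δ := by
    intro y
    by_cases hy : ∃ i, a i = y
    · obtain ⟨i, rfl⟩ := hy
      rw [hba, dist_comm]
      exact hchain i
    · rwa [hb, Function.extend_apply' _ _ _ hy, dist_self]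
  obtain ⟨g, hgf, hg⟩ := hpert f b hbf (range a) (finite_range a)
  exact ⟨g, hgf, N, hN, a, hlN, ⟨ha, fun i => hba i ▸ hg _ (mem_range_self i)⟩, haV⟩

end Cycles

section Traps

variable {X : Type*} [MetricSpace X] {N : ℕ} {a : ZMod N → X}

theorem IsLocallyConstantCycle.eventually_closedBall [NeZero N] {g : X → X}
    (hg : IsLocallyConstantCycle g a) :
    ∀ᶠ r in 𝓝 (0 : ℝ), Pairwise (Function.onFun Disjoint fun i => Metric.closedBall (a i) r) ∧
      ∀ i, ∀ y ∈ Metric.closedBall (a i) r, g y = a (i + 1) := by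
  refine .and (eventually_all.2 fun i => eventually_all.2 fun j =>
    eventually_imp_distrib_left.2 fun hij => ?_) (eventually_all.2 fun i =>
      eventually_closedBall_subset (hg.eventually_eq i))
  have hpos : 0 < dist (a i) (a j) / 2 := half_pos (dist_pos.2 (hg.injective.ne hij))
  filter_upwards [Iio_mem_nhds hpos] with r hr
  exact Metric.closedBall_disjoint_closedBall (by linarith [mem_Iio.1 hr])

theorem iterate_succ_mem_ball {f g : X → X} {r s : ℝ} (hsr : s ≤ r)
    (hg : ∀ i, ∀ y ∈ Metric.closedBall (a i) r, g y = a (i + 1)) (hfg : ∀ y, dist (f y) (g y) < s)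
    (k : ℕ) (i : ZMod N) {y : X} (hy : y ∈ Metric.closedBall (a i) r) :
    f^[k + 1] y ∈ Metric.ball (a (i + (k + 1 : ℕ))) s := by
  have hstep : ∀ i, ∀ y ∈ Metric.closedBall (a i) r, f y ∈ Metric.ball (a (i + 1)) s :=
    fun i y hy => hg i y hy ▸ hfg y
  induction k generalizing i y with
  | zero => simpa using hstep i y hy
  | succ k ih =>
    have := ih (i + 1) (Metric.ball_subset_closedBall.trans
      (Metric.closedBall_subset_closedBall hsr) (hstep i y hy))
    rwa [← Function.iterate_succ_apply, add_assoc, add_comm (1 : ZMod N), ← Nat.cast_succ] at this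

theorem IsLocallyConstantCycle.eventually_nontrivial [CompactSpace X] [NeZero N] {g : C(X, X)}
    (hg : IsLocallyConstantCycle g a) {i j : ZMod N} (hij : i ≠ j) {V : Set X} (hi : V ∈ 𝓝 (a i))
    (hj : V ∈ 𝓝 (a j)) : ∀ᶠ f : C(X, X) in 𝓝 g, (chainRecurrent f ∩ V).Nontrivial := by
  obtain ⟨r, hr, ⟨⟨hdisj, hgr⟩, hir⟩, hjr⟩ := (hg.eventually_closedBall.and
    (eventually_closedBall_subset hi) |>.and (eventually_closedBall_subset hj)).exists_gt
  filter_upwards [Metric.ball_mem_nhds g hr] with f hf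
  have hfg : ∀ y, dist (f y) (g y) < r := fun y => (ContinuousMap.dist_apply_le_dist y).trans_lt hf
  obtain ⟨n, rfl⟩ := Nat.exists_eq_succ_of_ne_zero (NeZero.ne N)
  have hrec : ∀ i, ∃ x ∈ Metric.closedBall (a i) r, x ∈ chainRecurrent f := fun i =>
    exists_mem_chainRecurrent_of_mapsTo f.continuous (isCompact_closedBall _ _)
      ⟨a i, Metric.mem_closedBall_self hr.le⟩ n.succ_ne_zero fun y hy => by
        simpa using Metric.ball_subset_closedBall (iterate_succ_mem_ball le_rfl hgr hfg n i hy)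
  obtain ⟨x, hx, hxf⟩ := hrec i
  obtain ⟨y, hy, hyf⟩ := hrec j
  exact ⟨x, ⟨hxf, hir hx⟩, y, ⟨hyf, hjr hy⟩, (hdisj hij).ne_of_mem hx hy⟩

theorem le_encard_range_iterate {α : Type*} {N : ℕ} [NeZero N] {D : ZMod N → Set α}
    (hD : Pairwise (Function.onFun Disjoint D)) {f : α → α} {x : α} {i : ZMod N}
    (hx : ∀ k : ℕ, f^[k] x ∈ D (i + k)) : (N : ℕ∞) ≤ (range fun k : ℕ => f^[k] x).encard := by
  have hinj : Function.Injective fun j : ZMod N => f^[j.val] x := by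
    intro j k hjk
    have hmem (j : ZMod N) : f^[j.val] x ∈ D (i + j) := by
      simpa only [ZMod.natCast_zmod_val] using hx j.val
    refine add_left_cancel (hD.eq (not_disjoint_iff.2 ⟨_, hmem j, ?_⟩))
    exact (show f^[j.val] x = f^[k.val] x from hjk) ▸ hmem k
  calc (N : ℕ∞) = ENat.card (ZMod N) := by rw [ENat.card_eq_coe_natCard, Nat.card_zmod]
    _ ≤ (range fun j : ZMod N => f^[j.val] x).encard := hinj.encard_range.ge
    _ ≤ (range fun k : ℕ => f^[k] x).encard :=
      encard_le_encard (range_comp_subset_range ZMod.val fun k : ℕ => f^[k] x)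

theorem IsLocallyConstantCycle.eventually_perGE [CompactSpace X] [NeZero N] (hW : WLPPP X)
    {g : C(X, X)} (hg : IsLocallyConstantCycle g a) {l : ℕ} (hl : l ≤ N) {i : ZMod N} {V : Set X}
    (hi : V ∈ 𝓝 (a i)) : ∀ᶠ f : C(X, X) in 𝓝 g, (perGE f l ∩ V).Nonempty := by
  obtain ⟨𝓑, h𝓑, hper⟩ := hW
  obtain ⟨r, hr, hdisj, hgr⟩ := hg.eventually_closedBall.exists_gt
  obtain ⟨B, hB, hiB, hBV⟩ := h𝓑.mem_nhds_iff.1 (inter_mem hi (Metric.ball_mem_nhds _ hr))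
  obtain ⟨s, hs, hsB⟩ := Metric.mem_nhds_iff.1 (h𝓑.mem_nhds hB hiB)
  filter_upwards [Metric.ball_mem_nhds g (lt_min hs hr)] with f hf
  have hfg : ∀ y, dist (f y) (g y) < min s r := fun y =>
    (ContinuousMap.dist_apply_le_dist y).trans_lt hf
  have hmem := iterate_succ_mem_ball (min_le_right s r) hgr hfg
  have hBr : closure B ⊆ Metric.closedBall (a i) r :=
    (closure_mono (hBV.trans inter_subset_right)).trans Metric.closure_ball_subset_closedBall
  obtain ⟨n, rfl⟩ := Nat.exists_eq_succ_of_ne_zero (NeZero.ne N)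
  obtain ⟨x, hxB, m, hm, hx⟩ := hper B hB ⟨f^[n + 1], f.continuous.iterate _⟩ <| by
    rintro - ⟨y, hy, rfl⟩
    have hy' := hmem n i (hBr hy)
    rw [← Nat.succ_eq_add_one, ZMod.natCast_self, add_zero] at hy'
    exact hsB (Metric.ball_subset_ball (min_le_left s r) hy')
  have hxr : x ∈ Metric.closedBall (a i) r := hBr (subset_closure hxB)
  have horbit : ∀ k : ℕ, f^[k] x ∈ Metric.closedBall (a (i + k)) r
    | 0 => by simpa using hxr
    | k + 1 => Metric.ball_subset_closedBall
        (Metric.ball_subset_ball (min_le_right s r) (hmem k i hxr))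
  refine ⟨x, ⟨⟨(n + 1) * m, by positivity, ?_⟩, ?_⟩, (hBV hxB).1⟩
  · rw [Function.IsPeriodicPt, Function.iterate_mul]
    exact hx
  · exact (Nat.cast_le.2 hl).trans (le_encard_range_iterate hdisj horbit)

theorem PerturbationProperty.eventually_chainRecurrent [CompactSpace X] [PerfectSpace X]
    (hP : PerturbationProperty X X) {Q : C(X, X) → Set X → Prop} (hmono : ∀ f, Monotone (Q f))
    (l : ℕ) (hQ : ∀ (g : C(X, X)) (N : ℕ) [NeZero N] (a : ZMod N → X) (V : Set X), l ≤ N →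
      IsLocallyConstantCycle g a → V ∈ 𝓝 (a 0) → (∃ j ≠ 0, V ∈ 𝓝 (a j)) →
      ∀ᶠ f in 𝓝 g, Q f V) :
    ∀ᶠ f : C(X, X) in residual C(X, X), ∀ x ∈ chainRecurrent f, ∀ V ∈ 𝓝 x, Q f V := by
  refine eventually_residual_forall_mem_nhds isClosed_setOf_mem_chainRecurrent hmono
    fun f x hx V hV => Metric.mem_closure_iff.2 fun ε hε => ?_
  obtain ⟨g, hgf, N, hN, a, hlN, ha, h0, j, hj, hjV⟩ :=
    hP.exists_isLocallyConstantCycle f hx (interior_mem_nhds.2 hV) hε l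
  refine ⟨g, mem_interior_iff_mem_nhds.2 (hQ g N a V hlN ha (mem_interior_iff_mem_nhds.1 h0)
    ⟨j, hj, mem_interior_iff_mem_nhds.1 hjV⟩), ?_⟩
  rw [dist_comm]
  exact (ContinuousMap.dist_lt_iff hε).2 hgf

theorem PerturbationProperty.eventually_perfect [CompactSpace X] [PerfectSpace X]
    (hP : PerturbationProperty X X) :
    ∀ᶠ f : C(X, X) in residual C(X, X), Perfect (chainRecurrent f) := by
  have hnontrivial := hP.eventually_chainRecurrent
    (Q := fun f V => (chainRecurrent f ∩ V).Nontrivial)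
    (fun f _ _ hVW h => h.mono (inter_subset_inter_right _ hVW)) 0
    fun g N _ a V _ ha h0 ⟨j, hj, hjV⟩ => ha.eventually_nontrivial hj.symm h0 hjV
  filter_upwards [hnontrivial] with f hf
  refine ⟨isClosed_chainRecurrent f, fun x hx => accPt_iff_nhds.2 fun V hV => ?_⟩
  obtain ⟨y, ⟨hy, hyV⟩, hyx⟩ := (hf x hx V hV).exists_ne x
  exact ⟨y, ⟨hyV, hy⟩, hyx⟩

theorem PerturbationProperty.eventually_closure_perGE [CompactSpace X] [PerfectSpace X]
    (hP : PerturbationProperty X X) (hW : WLPPP X) (l : ℕ) :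
    ∀ᶠ f : C(X, X) in residual C(X, X), closure (perGE f l) = chainRecurrent f := by
  have hdense := hP.eventually_chainRecurrent (Q := fun f V => (perGE f l ∩ V).Nonempty)
    (fun f _ _ hVW h => h.mono (inter_subset_inter_right _ hVW)) l
    fun g N _ a V hl ha h0 _ => ha.eventually_perGE hW hl h0
  filter_upwards [hdense] with f hf
  refine (closure_perGE_subset_chainRecurrent f l).antisymm fun x hx =>
    mem_closure_iff_nhds.2 fun V hV => ?_
  rw [inter_comm]
  exact hf x hx V hV

end Traps

end GenericCR

theorem theorem6p2 (X : Type u) [MetricSpace X] [CompactSpace X] [PerfectSpace X]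
    (hX : GenericCR.IsANR X ∨
      ∃ n : ℕ, GenericCR.IsNDimensional X n ∧ GenericCR.IsLC X ((n : ℤ) - 1)) :
    (∀ᶠ f : C(X, X) in residual C(X, X), Perfect (GenericCR.chainRecurrent f)) ∧
    (GenericCR.WLPPP X → ∀ l : ℕ, 2 ≤ l →
      ∀ᶠ f : C(X, X) in residual C(X, X),
        Perfect (GenericCR.chainRecurrent f) ∧
          closure (GenericCR.perGE f l) = GenericCR.chainRecurrent f) := by
  have hP : GenericCR.PerturbationProperty X X := by
    rcases hX with hANR | ⟨n, hdim, hLC⟩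
    · exact (GenericCR.hasFiniteRefinements_top X).perturbationProperty hANR.hasSimplicialExtension
    · exact hdim.1.hasFiniteRefinements.perturbationProperty <|
        GenericCR.hasSimplicialExtension_of_locallyKConnected n fun k hk => hLC k (by omega)
  exact ⟨hP.eventually_perfect, fun hW l _ =>
    hP.eventually_perfect.and (hP.eventually_closure_perGE hW l)⟩
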